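/- A C$^*$-algebra $A$ (not necessarily unital) is called a SAW$^*$-algebra if for any two positive elements $x,y\in A$ with $xy=0$ there is a positive element $e\in A$ such that $ex=x$ and $ey=0$. For C$^*$-algebras $B$ and $C$ and a C$^*$-norm $\nu$ on their algebraic tensor product $B\odot C$ over $\mathbb{C}$ (that is, a norm satisfying $\nu(st)\le\nu(s)\nu(t)$ and $\nu(t^*t)=\nu(t)^2$ for all $s,t\in B\odot C$), let $B\otimes_\nu C$ denote the completion of $B\odot C$ with respect to $\nu$, which is a C$^*$-algebra. Theorem. Every SAW$^*$-algebra is essentially non-factorizable: if $A$ is a SAW$^*$-algebra, $B$ and $C$ are infinite-dimensional C$^*$-algebras (not necessarily unital), and $\nu$ is a C$^*$-norm on $B\odot C$, then $A$ is not $*$-isomorphic to $B\otimes_\nu C$. -/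

import Mathlib

open scoped TensorProduct

noncomputable section

/-- A C⋆-norm on a complex ⋆-algebra `E` (not assumed complete, nor unital): a norm that is
submultiplicative and satisfies the C⋆-identity. -/
structure CStarNorm (E : Type*) [NonUnitalRing E] [StarRing E] [Module ℂ E]
    extends Seminorm ℂ E where
  eq_zero_of_map_eq_zero' : ∀ x : E, toFun x = 0 → x = 0
  mul_le' : ∀ x y : E, toFun (x * y) ≤ toFun x * toFun y
  star_mul_self' : ∀ x : E, toFun (star x * x) = toFun x ^ 2

namespace CStarNorm

section General

variable {E : Type*} [NonUnitalRing E] [StarRing E] [Module ℂ E]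

/-- The ⋆-algebra `E`, regarded as a normed space through the C⋆-norm `ν`. -/
def Normed (_ν : CStarNorm E) : Type _ := E

variable (ν : CStarNorm E)

instance : NonUnitalRing ν.Normed := inferInstanceAs (NonUnitalRing E)

instance : StarRing ν.Normed := inferInstanceAs (StarRing E)

instance : Module ℂ ν.Normed := inferInstanceAs (Module ℂ E)

instance [StarModule ℂ E] : StarModule ℂ ν.Normed := inferInstanceAs (StarModule ℂ E)

instance [IsScalarTower ℂ E E] : IsScalarTower ℂ ν.Normed ν.Normed :=
  inferInstanceAs (IsScalarTower ℂ E E)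

instance [SMulCommClass ℂ E E] : SMulCommClass ℂ ν.Normed ν.Normed :=
  inferInstanceAs (SMulCommClass ℂ E E)

/-- The norm `ν` as a norm on the group `ν.Normed`. -/
def toAddGroupNorm : AddGroupNorm ν.Normed where
  toFun := ν.toFun
  map_zero' := ν.map_zero'
  add_le' := ν.add_le'
  neg' := ν.neg'
  eq_zero_of_map_eq_zero' := ν.eq_zero_of_map_eq_zero'

instance : NormedAddCommGroup ν.Normed := ν.toAddGroupNorm.toNormedAddCommGroup

theorem norm_def (x : ν.Normed) : ‖x‖ = ν.toSeminorm x := rfl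

instance : NonUnitalNormedRing ν.Normed where
  __ : NormedAddCommGroup ν.Normed := inferInstance
  __ : NonUnitalRing ν.Normed := inferInstance
  norm_mul_le x y := ν.mul_le' x y

instance : NormedSpace ℂ ν.Normed where
  norm_smul_le c x := (map_smul_eq_mul ν.toSeminorm c x).le

instance : CStarRing ν.Normed where
  norm_mul_self_le x := by
    have h : ‖star x * x‖ = ‖x‖ ^ 2 := ν.star_mul_self' x
    rw [h, sq]

/-- The completion of the ⋆-algebra `E` with respect to the C⋆-norm `ν`. Addition, scalar
multiplication and the norm are those of the completion of a normed space; multiplication and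
involution are the continuous extensions of those of `E`. -/
def Completion : Type _ := UniformSpace.Completion ν.Normed

namespace Completion

instance : NormedAddCommGroup ν.Completion :=
  inferInstanceAs (NormedAddCommGroup (UniformSpace.Completion ν.Normed))

instance : NormedSpace ℂ ν.Completion :=
  inferInstanceAs (NormedSpace ℂ (UniformSpace.Completion ν.Normed))

instance : CompleteSpace ν.Completion :=
  inferInstanceAs (CompleteSpace (UniformSpace.Completion ν.Normed))

/-- The canonical isometric embedding of `E`, normed by `ν`, in its completion. -/
def coe : ν.Normed →ₗᵢ[ℂ] ν.Completion :=
  UniformSpace.Completion.toComplₗᵢ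

theorem denseRange_coe : DenseRange (coe ν) :=
  UniformSpace.Completion.denseRange_coe

theorem isDenseInducing_coe : IsDenseInducing (coe ν) :=
  UniformSpace.Completion.isDenseInducing_coe

instance : Mul ν.Completion where
  mul := Function.curry
    (((isDenseInducing_coe ν).prodMap (isDenseInducing_coe ν)).extend
      fun p => coe ν (p.1 * p.2))

instance : Star ν.Completion where
  star := (isDenseInducing_coe ν).extend fun x => coe ν (star x)

theorem coe_mul (x y : ν.Normed) : coe ν (x * y) = coe ν x * coe ν y :=
  (((isDenseInducing_coe ν).prodMap (isDenseInducing_coe ν)).extend_eq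
    ((coe ν).continuous.comp continuous_mul) (x, y)).symm

theorem coe_star (x : ν.Normed) : coe ν (star x) = star (coe ν x) :=
  ((isDenseInducing_coe ν).extend_eq ((coe ν).continuous.comp continuous_star) x).symm

instance : ContinuousMul ν.Completion where
  continuous_mul := by
    let m : ν.Normed →+ ν.Normed →+ ν.Completion :=
      AddMonoidHom.mul.compr₂ (coe ν).toLinearMap.toAddMonoidHom
    have hm : Continuous fun p : ν.Normed × ν.Normed => m p.1 p.2 :=
      (coe ν).continuous.comp continuous_mul
    have di : IsDenseInducing ((coe ν).toLinearMap.toAddMonoidHom : ν.Normed → ν.Completion) :=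
      isDenseInducing_coe ν
    exact di.extend_Z_bilin di hm

instance : ContinuousStar ν.Completion where
  continuous_star := by
    have h : UniformContinuous fun x : ν.Normed => coe ν (star x) :=
      ((coe ν).isometry.comp
        (AddMonoidHomClass.isometry_of_norm (starAddEquiv : ν.Normed ≃+ ν.Normed)
          fun x => norm_star x)).uniformContinuous
    exact (uniformContinuous_uniformly_extend
      (coe ν).isometry.isUniformInducing (denseRange_coe ν) h).continuous

theorem ind {p : ν.Completion → Prop} (hp : IsClosed {x | p x}) (h : ∀ x, p (coe ν x)) (x) : p x :=
  (denseRange_coe ν).induction_on x hp h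

theorem ind₂ {p : ν.Completion → ν.Completion → Prop}
    (hp : IsClosed {x : ν.Completion × ν.Completion | p x.1 x.2})
    (h : ∀ x y, p (coe ν x) (coe ν y)) (x y) : p x y :=
  (denseRange_coe ν).induction_on₂ hp h x y

theorem ind₃ {p : ν.Completion → ν.Completion → ν.Completion → Prop}
    (hp : IsClosed {x : ν.Completion × ν.Completion × ν.Completion | p x.1 x.2.1 x.2.2})
    (h : ∀ x y z, p (coe ν x) (coe ν y) (coe ν z)) (x y z) : p x y z :=
  (denseRange_coe ν).induction_on₃ hp h x y z

instance : NonUnitalRing ν.Completion where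
  zero_mul := ind ν (isClosed_eq (by fun_prop) (by fun_prop)) fun x => by
    rw [← map_zero (coe ν), ← coe_mul, zero_mul]
  mul_zero := ind ν (isClosed_eq (by fun_prop) (by fun_prop)) fun x => by
    rw [← map_zero (coe ν), ← coe_mul, mul_zero]
  mul_assoc := ind₃ ν (isClosed_eq (by fun_prop) (by fun_prop)) fun x y z => by
    simp only [← coe_mul, mul_assoc]
  left_distrib := ind₃ ν (isClosed_eq (by fun_prop) (by fun_prop)) fun x y z => by
    simp only [← coe_mul, ← map_add, mul_add]
  right_distrib := ind₃ ν (isClosed_eq (by fun_prop) (by fun_prop)) fun x y z => by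
    simp only [← coe_mul, ← map_add, add_mul]

instance : NonUnitalNormedRing ν.Completion where
  __ : NormedAddCommGroup ν.Completion := inferInstance
  __ : NonUnitalRing ν.Completion := inferInstance
  norm_mul_le := ind₂ ν (isClosed_le (by fun_prop) (by fun_prop)) fun x y => by
    simpa only [← coe_mul, LinearIsometry.norm_map] using norm_mul_le x y

instance : StarRing ν.Completion where
  star_involutive := ind ν (isClosed_eq (by fun_prop) (by fun_prop)) fun x => by
    simp only [← coe_star, star_star]
  star_mul := ind₂ ν (isClosed_eq (by fun_prop) (by fun_prop)) fun x y => by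
    simp only [← coe_star, ← coe_mul, star_mul]
  star_add := ind₂ ν (isClosed_eq (by fun_prop) (by fun_prop)) fun x y => by
    simp only [← coe_star, ← map_add, star_add]

instance : CStarRing ν.Completion where
  norm_mul_self_le := ind ν (isClosed_le (by fun_prop) (by fun_prop)) fun x => by
    simpa only [← coe_star, ← coe_mul, LinearIsometry.norm_map] using CStarRing.norm_mul_self_le x

instance [IsScalarTower ℂ E E] : IsScalarTower ℂ ν.Completion ν.Completion where
  smul_assoc c := ind₂ ν (p := fun x y => (c • x) * y = c • (x * y))
    (isClosed_eq (((continuous_const_smul c).comp continuous_fst).mul continuous_snd)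
      ((continuous_const_smul c).comp continuous_mul)) fun x y => by
      rw [← map_smul, ← coe_mul, ← coe_mul, ← map_smul, smul_mul_assoc]

instance [SMulCommClass ℂ E E] : SMulCommClass ℂ ν.Completion ν.Completion where
  smul_comm c := ind₂ ν (p := fun x y => c • (x * y) = x * (c • y))
    (isClosed_eq ((continuous_const_smul c).comp continuous_mul)
      (continuous_fst.mul ((continuous_const_smul c).comp continuous_snd))) fun x y => by
      rw [← map_smul, ← coe_mul, ← coe_mul, ← map_smul, mul_smul_comm]

instance [StarModule ℂ E] : StarModule ℂ ν.Completion where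
  star_smul c := ind ν (p := fun x => star (c • x) = star c • star x)
    (isClosed_eq (continuous_star.comp (continuous_const_smul c))
      ((continuous_const_smul (star c)).comp continuous_star)) fun x => by
      rw [← map_smul, ← coe_star, ← coe_star, ← map_smul, star_smul]

/-- The completion of a complex ⋆-algebra in a C⋆-norm is a C⋆-algebra. -/
instance [StarModule ℂ E] [IsScalarTower ℂ E E] [SMulCommClass ℂ E E] :
    NonUnitalCStarAlgebra ν.Completion where

end Completion

end General

end CStarNorm

/-- The C⋆-tensor product `B ⊗_ν C`: the completion of the algebraic tensor product of `B` and `C`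
over `ℂ`, with the product `(b ⊗ c) (b' ⊗ c') = b b' ⊗ c c'` and the involution
`(b ⊗ c)⋆ = b⋆ ⊗ c⋆`, in the C⋆-norm `ν`. -/
abbrev CStarTensorProduct (B C : Type*) [NonUnitalCStarAlgebra B] [NonUnitalCStarAlgebra C]
    (ν : CStarNorm (B ⊗[ℂ] C)) : Type _ :=
  ν.Completion

/-- A (not necessarily unital) C⋆-algebra is a SAW⋆-algebra if for any two orthogonal positive
elements `x` and `y` there is a positive `e` with `e x = x` and `e y = 0`. -/
def IsSAWStarAlgebra (A : Type*) [NonUnitalCStarAlgebra A] [PartialOrder A]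
    [StarOrderedRing A] : Prop :=
  ∀ x y : A, 0 ≤ x → 0 ≤ y → x * y = 0 → ∃ e : A, 0 ≤ e ∧ e * x = x ∧ e * y = 0

end

/-! An infinite-dimensional C⋆-algebra has an infinite orthogonal sequence of positive elements,
since otherwise its unit is a finite sum of minimal projections and the algebra is
finite-dimensional (`hasOrthogonalSequence_of_not_finiteDimensional`). This yields orthogonal local
units `s m` in `B` and `t n` in `C`. If `B ⊗_ν C` were SAW⋆, some `e` would act as `1` under `s m ⊗
t n` for `m = n` and as `0` for `m ≠ n` (`IsSAWStarAlgebra.exists_separating`).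

A finite sum `∑ bᵢ ⊗ cᵢ` near `e` cannot do this. Excision (`exists_excision_family`) gives unit
vectors `a m` under `s m` with `(a m)⋆ bᵢ (a m) ≈ μ m i • (a m)⋆ (a m)`. Compressing by `a m` thus
replaces the sum by `h m = ∑ μ m i • cᵢ`, which lies in a bounded part of a finite-dimensional
space. Two of these nearly coincide, yet under `t m` one acts as `1` and the other as `0`. Because
`ν` is arbitrary, the estimates rely on every C⋆-norm being a cross norm
(`IsCStarTensorMap.norm_map`). -/

noncomputable section

/-! ### Local units and excision by functional calculus. -/

section PositiveElements

variable {B : Type*} [NonUnitalCStarAlgebra B] [PartialOrder B] [StarOrderedRing B]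

/-- A positive contraction acting as a left unit on some nonzero element. -/
structure IsLocalUnit (s : B) : Prop where
  nonneg : 0 ≤ s
  norm_le_one : ‖s‖ ≤ 1
  exists_fixed : ∃ a : B, a ≠ 0 ∧ s * a = a

omit [StarOrderedRing B] in
theorem IsLocalUnit.exists_norm_eq_one {s : B} (hs : IsLocalUnit s) :
    ∃ a : B, ‖a‖ = 1 ∧ s * a = a := by
  obtain ⟨a, ha, hsa⟩ := hs.exists_fixed
  refine ⟨((‖a‖⁻¹ : ℝ) : ℂ) • a, ?_, ?_⟩
  · rw [norm_smul]
    simp [ha]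
  · rw [mul_smul_comm, hsa]

theorem exists_pos_mem_quasispectrum {p : B} (hp : 0 ≤ p) (hp0 : p ≠ 0) :
    ∃ x ∈ quasispectrum ℝ p, 0 < x := by
  by_contra! h
  refine hp0 (CFC.eq_zero_of_quasispectrum_eq_zero (R := ℝ) p (fun x hx => ?_) (IsSelfAdjoint.of_nonneg hp))
  exact le_antisymm (h x hx) (quasispectrum_nonneg_of_nonneg p hp x hx)

/-- With `x > 0` in the spectrum, `f` vanishes up to `x / 4` and equals `1` from `x / 2` on, where
`g` lives; hence `f g = g` and `f` is divisible by `t`. The factor `p` on the left passes to `s`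
whatever fixes or annihilates `p` from the left. -/
theorem exists_isLocalUnit_eq_mul {p : B} (hp : 0 ≤ p) (hp0 : p ≠ 0) :
    ∃ s : B, IsLocalUnit s ∧ ∃ y, s = p * y := by
  obtain ⟨x, hx, hx0⟩ := exists_pos_mem_quasispectrum hp hp0
  have hsa : IsSelfAdjoint p := .of_nonneg hp
  set f : ℝ → ℝ := fun t => min 1 (4 / x * max 0 (t - x / 4)) with hf
  set k : ℝ → ℝ := fun t => f t / max t (x / 4) with hk
  set g : ℝ → ℝ := fun t => max 0 (t - x / 2) with hg
  have hpos : ∀ t : ℝ, 0 < max t (x / 4) := fun t => lt_max_of_lt_right (by positivity)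
  have hfc : Continuous f := by fun_prop
  have hkc : Continuous k := hfc.div (by fun_prop) fun t => (hpos t).ne'
  have hgc : Continuous g := by fun_prop
  have hf0 : f 0 = 0 := by
    simp only [hf]
    rw [max_eq_left (by linarith)]; simp
  have hk0 : k 0 = 0 := by simp [hk, hf0]
  have hg0 : g 0 = 0 := by
    simp only [hg]
    rw [max_eq_left (by linarith)]
  have hfnn : ∀ t, 0 ≤ f t := fun t => le_min zero_le_one (by positivity)
  refine ⟨cfcₙ f p, ⟨cfcₙ_nonneg fun t _ => hfnn t, norm_cfcₙ_le fun t _ => ?_, cfcₙ g p, ?_, ?_⟩,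
    cfcₙ k p, ?_⟩
  · rw [Real.norm_of_nonneg (hfnn t)]
    exact min_le_left _ _
  · intro h
    rw [← cfcₙ_zero ℝ p] at h
    have := eqOn_of_cfcₙ_eq_cfcₙ h hsa hgc.continuousOn hg0 continuousOn_const rfl hx
    simp only [hg, Pi.zero_apply] at this
    rw [max_eq_right (by linarith)] at this
    linarith
  · rw [← cfcₙ_mul f g p hfc.continuousOn hf0 hgc.continuousOn hg0]
    refine cfcₙ_congr fun t _ => ?_
    rcases le_total t (x / 2) with h | h
    · simp only [hg]
      rw [max_eq_left (by linarith), mul_zero]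
    · have : f t = 1 := by
        simp only [hf]
        rw [max_eq_right (by linarith), min_eq_left]
        rw [div_mul_eq_mul_div, le_div_iff₀ hx0]
        linarith
      simp [this]
  · conv_rhs => enter [1]; rw [← cfcₙ_id' ℝ p]
    rw [← cfcₙ_mul (fun t => t) k p continuousOn_id rfl hkc.continuousOn hk0]
    refine cfcₙ_congr fun t _ => ?_
    rcases le_total t (x / 4) with h | h
    · simp only [hk]
      have : f t = 0 := by
        simp only [hf]
        rw [max_eq_left (by linarith)]
        simp
      simp [this]
    · simp only [hk]
      rw [max_eq_left h, mul_div_cancel₀]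
      linarith

theorem IsLocalUnit.exists_mul_eq {r : B} (hr : IsLocalUnit r) :
    ∃ s : B, IsLocalUnit s ∧ r * s = s := by
  obtain ⟨a, ha, hra⟩ := hr.exists_fixed
  obtain ⟨s, hs, y, rfl⟩ := exists_isLocalUnit_eq_mul (mul_star_self_nonneg a)
    (CStarRing.mul_star_self_ne_zero_iff a |>.2 ha)
  exact ⟨_, hs, by rw [← mul_assoc, ← mul_assoc, hra]⟩

/-- The cut-off `a = (g - c)₊` is supported where `g` exceeds `c`. -/
theorem exists_smul_mul_self_le_conjugate {g : B} (hg : 0 ≤ g) {c : ℝ} (hc : 0 ≤ c)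
    (hcg : c < ‖g‖) : ∃ a : B, 0 ≤ a ∧ a ≠ 0 ∧ c • (a * a) ≤ a * g * a := by
  have hsa : IsSelfAdjoint g := .of_nonneg hg
  obtain ⟨x, hx, hcx⟩ : ∃ x ∈ quasispectrum ℝ g, c < x := by
    by_contra! h
    refine hcg.not_ge ?_
    rw [← cfcₙ_id' ℝ g]
    refine norm_cfcₙ_le fun t ht => ?_
    rw [Real.norm_of_nonneg (quasispectrum_nonneg_of_nonneg g hg t ht)]
    exact h t ht
  set f : ℝ → ℝ := fun t => max 0 (t - c) with hf
  have hfc : Continuous f := by fun_prop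
  have hf0 : f 0 = 0 := by simp [hf, hc]
  refine ⟨cfcₙ f g, cfcₙ_nonneg fun t _ => le_max_left _ _, ?_, ?_⟩
  · intro h
    rw [← cfcₙ_zero ℝ g] at h
    have := eqOn_of_cfcₙ_eq_cfcₙ h hsa hfc.continuousOn hf0 continuousOn_const rfl hx
    simp only [hf, Pi.zero_apply] at this
    rw [max_eq_right (by linarith)] at this
    linarith
  · have h1 : cfcₙ f g * g * cfcₙ f g = cfcₙ (fun t => f t * t * f t) g := by
      rw [cfcₙ_mul (fun t => f t * t) f g (by fun_prop) (by simp) (by fun_prop) hf0,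
        cfcₙ_mul f (fun t => t) g (by fun_prop) hf0 (by fun_prop) rfl, cfcₙ_id' ℝ g]
    have h2 : c • (cfcₙ f g * cfcₙ f g) = cfcₙ (fun t => c • (f t * f t)) g := by
      rw [cfcₙ_smul c (fun t => f t * f t) g (by fun_prop) (by simp [hf0]),
        cfcₙ_mul f f g (by fun_prop) hf0 (by fun_prop) hf0]
    rw [h1, h2]
    refine cfcₙ_mono (fun t _ => ?_) (by fun_prop) (by fun_prop) (by simp [hf0]) (by simp [hf0])
    rcases le_total t c with h | h
    · have : f t = 0 := max_eq_left (by linarith)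
      simp [this]
    · have : 0 ≤ f t * f t := mul_self_nonneg _
      simp only [smul_eq_mul]
      nlinarith

/-- Minimise `‖s * f * s‖` over local units under `r`. A near-minimiser `s₀` bounds `f` above by `l
+ δ` on everything under it. Passing further down cannot push the norm below `l`, so a spectral cut
finds a direction where `f` is at least `l - δ`. The gap is `2 * δ = ε`. -/
theorem exists_excision_of_nonneg {r f : B} (hr : IsLocalUnit r) (hf : 0 ≤ f) {ε : ℝ}
    (hε : 0 < ε) : ∃ s : B, IsLocalUnit s ∧ r * s = s ∧ ∃ μ : ℝ, ∀ a : B, s * a = a →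
      ‖star a * f * a - μ • (star a * a)‖ ≤ ε * ‖a‖ ^ 2 := by
  set S : Set ℝ := {x | ∃ s : B, IsLocalUnit s ∧ r * s = s ∧ ‖s * f * s‖ = x} with hS
  have hSne : S.Nonempty := by
    obtain ⟨s, hs, hrs⟩ := hr.exists_mul_eq
    exact ⟨_, s, hs, hrs, rfl⟩
  have hSbdd : BddBelow S := ⟨0, by rintro _ ⟨s, -, -, rfl⟩; positivity⟩
  set δ : ℝ := ε / 2 with hδ
  have hδ0 : 0 < δ := by positivity
  obtain ⟨_, ⟨s₀, hs₀, hrs₀, rfl⟩, hlt⟩ := exists_lt_of_csInf_lt hSne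
    (show sInf S < sInf S + δ by linarith)
  set l : ℝ := sInf S with hl
  have hconj : ∀ s : B, 0 ≤ s → 0 ≤ s * f * s := fun s hs => by
    have := star_left_conjugate_nonneg hf s
    rwa [(IsSelfAdjoint.of_nonneg hs).star_eq] at this
  have upper : ∀ a : B, s₀ * a = a → star a * f * a ≤ (l + δ) • (star a * a) := fun a ha => by
    have h1 : star a * f * a = star a * (s₀ * f * s₀) * a := by
      have : star a * s₀ = star a := by
        conv_rhs => rw [← ha, star_mul, (IsSelfAdjoint.of_nonneg hs₀.nonneg).star_eq]
      calc star a * f * a = (star a * s₀) * f * (s₀ * a) := by rw [this, ha]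
        _ = _ := by simp only [mul_assoc]
    rw [h1]
    refine (CStarAlgebra.star_left_conjugate_le_norm_smul (.of_nonneg (hconj _ hs₀.nonneg))).trans ?_
    exact smul_le_smul_of_nonneg_right hlt.le (star_mul_self_nonneg a)
  have key : ∀ (μ : ℝ) (a : B), l + δ - μ ≤ ε → s₀ * a = a →
      μ • (star a * a) ≤ star a * f * a →
      ‖star a * f * a - μ • (star a * a)‖ ≤ ε * ‖a‖ ^ 2 := fun μ a hμ ha h => by
    have h2 : star a * f * a - μ • (star a * a) ≤ ε • (star a * a) := by
      calc _ ≤ (l + δ) • (star a * a) - μ • (star a * a) := sub_le_sub_right (upper a ha) _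
        _ = (l + δ - μ) • (star a * a) := (sub_smul _ _ _).symm
        _ ≤ _ := smul_le_smul_of_nonneg_right hμ (star_mul_self_nonneg a)
    refine (CStarAlgebra.norm_le_norm_of_nonneg_of_le (sub_nonneg.2 h) h2).trans ?_
    rw [norm_smul, CStarRing.norm_star_mul_self, Real.norm_of_nonneg hε.le, sq]
  rcases le_or_gt l δ with hlδ | hlδ
  -- When `l ≤ δ`, positivity of `f` already supplies the lower bound, with `μ = 0`.
  · refine ⟨s₀, hs₀, hrs₀, 0, fun a ha => key 0 a (by linarith) ha ?_⟩
    rw [zero_smul]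
    exact star_left_conjugate_nonneg hf a
  · obtain ⟨s₁, hs₁, h01⟩ := hs₀.exists_mul_eq
    have hrs₁ : r * s₁ = s₁ := by rw [← h01, ← mul_assoc, hrs₀]
    have hl1 : l ≤ ‖s₁ * f * s₁‖ := csInf_le hSbdd ⟨s₁, hs₁, hrs₁, rfl⟩
    obtain ⟨b, hb, hb0, hle⟩ := exists_smul_mul_self_le_conjugate (hconj s₁ hs₁.nonneg)
      (c := l - δ) (by linarith) (by linarith)
    have hbs : star b = b := (IsSelfAdjoint.of_nonneg hb).star_eq
    have hs₁s : star s₁ = s₁ := (IsSelfAdjoint.of_nonneg hs₁.nonneg).star_eq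
    set d := s₁ * b with hd
    have hrd : r * d = d := by rw [hd, ← mul_assoc, hrs₁]
    have h0d : s₀ * d = d := by rw [hd, ← mul_assoc, h01]
    have hdf : star d * f * d = b * (s₁ * f * s₁) * b := by
      rw [hd, star_mul, hbs, hs₁s]; simp only [mul_assoc]
    have hdd : star d * d ≤ b * b := by
      have h1 : star d * d = star b * (s₁ * s₁) * b := by
        rw [hd, star_mul, hbs, hs₁s]; simp only [mul_assoc]
      have h2 : IsSelfAdjoint (s₁ * s₁) := by
        rw [isSelfAdjoint_iff, star_mul, hs₁s]
      rw [h1]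
      refine (CStarAlgebra.star_left_conjugate_le_norm_smul h2).trans ?_
      calc _ ≤ (1 : ℝ) • (star b * b) := by
            refine smul_le_smul_of_nonneg_right ?_ (star_mul_self_nonneg b)
            exact (norm_mul_le _ _).trans
              (mul_le_one₀ hs₁.norm_le_one (norm_nonneg _) hs₁.norm_le_one)
        _ = b * b := by rw [one_smul, hbs]
    have hlow : (l - δ) • (star d * d) ≤ star d * f * d := by
      rw [hdf]
      exact (smul_le_smul_of_nonneg_left hdd (by linarith)).trans hle
    have hd0 : d ≠ 0 := by
      intro h0
      have h1 : (l - δ) • (b * b) ≤ 0 := by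
        refine hle.trans_eq ?_
        rw [← hdf, h0, mul_zero]
      have hbb : 0 ≤ b * b := by simpa only [hbs] using star_mul_self_nonneg b
      have h2 := le_antisymm h1 (smul_nonneg (by linarith) hbb)
      rw [smul_eq_zero_iff_right (by linarith)] at h2
      refine hb0 ((CStarRing.star_mul_self_eq_zero_iff b).1 ?_)
      rwa [hbs]
    -- Since `s` lies in `d * B`, every `a` fixed by `s` is a right multiple of `d` and inherits its
    -- lower bound.
    obtain ⟨s, hs, y, hsy⟩ := exists_isLocalUnit_eq_mul (mul_star_self_nonneg d)
      (CStarRing.mul_star_self_ne_zero_iff d |>.2 hd0)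
    have hsd : s = d * (star d * y) := by rw [hsy, mul_assoc]
    refine ⟨s, hs, ?_, l - δ, fun a ha => ?_⟩
    · rw [hsd, ← mul_assoc, hrd]
    · have haz : a = d * (star d * y * a) := by rw [← mul_assoc, ← hsd, ha]
      refine key _ a (by linarith) ?_ ?_
      · rw [haz, ← mul_assoc, h0d]
      · set z := star d * y * a with hz
        have h := star_left_conjugate_le_conjugate hlow z
        rw [haz, star_mul]
        convert h using 1
        · rw [mul_smul_comm, smul_mul_assoc]; simp only [mul_assoc]
        · simp only [mul_assoc]

/-- Positive elements span. For a sum, the second summand is excised under the unit found for the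
first, so both estimates survive; this is why the induction generalises `r`. -/
theorem exists_excision {r : B} (hr : IsLocalUnit r) (f : B) {ε : ℝ} (hε : 0 < ε) :
    ∃ s : B, IsLocalUnit s ∧ r * s = s ∧ ∃ μ : ℂ, ∀ a : B, s * a = a →
      ‖star a * f * a - μ • (star a * a)‖ ≤ ε * ‖a‖ ^ 2 := by
  have hf : f ∈ Submodule.span ℂ {a : B | 0 ≤ a} := by
    rw [CStarAlgebra.span_nonneg]; trivial
  induction hf using Submodule.span_induction generalizing r ε with
  | mem x hx =>
    obtain ⟨s, hs, hrs, μ, h⟩ := exists_excision_of_nonneg hr hx hε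
    refine ⟨s, hs, hrs, μ, fun a ha => ?_⟩
    simpa only [Complex.coe_smul] using h a ha
  | zero =>
    obtain ⟨s, hs, hrs⟩ := hr.exists_mul_eq
    refine ⟨s, hs, hrs, 0, fun a _ => ?_⟩
    simp only [mul_zero, zero_mul, zero_smul, sub_zero, norm_zero]
    positivity
  | add x y _ _ hx hy =>
    obtain ⟨s, hs, hrs, μ, h⟩ := hx hr (half_pos hε)
    obtain ⟨s', hs', hss', μ', h'⟩ := hy hs (half_pos hε)
    refine ⟨s', hs', by rw [← hss', ← mul_assoc, hrs], μ + μ', fun a ha => ?_⟩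
    have e : star a * (x + y) * a - (μ + μ') • (star a * a) =
        (star a * x * a - μ • (star a * a)) + (star a * y * a - μ' • (star a * a)) := by
      rw [mul_add, add_mul, add_smul]; abel
    rw [e]
    have h1 := h a (by rw [← ha, ← mul_assoc, hss'])
    have h2 := h' a ha
    refine (norm_add_le _ _).trans ?_
    linarith
  | smul c x _ hx =>
    obtain ⟨s, hs, hrs, μ, h⟩ := hx hr (ε := ε / (‖c‖ + 1)) (by positivity)
    refine ⟨s, hs, hrs, c * μ, fun a ha => ?_⟩
    rw [mul_smul_comm, smul_mul_assoc, mul_smul, ← smul_sub, norm_smul]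
    calc ‖c‖ * ‖star a * x * a - μ • (star a * a)‖
        ≤ (‖c‖ + 1) * (ε / (‖c‖ + 1) * ‖a‖ ^ 2) := by
          gcongr
          · linarith
          · exact h a ha
      _ = ε * ‖a‖ ^ 2 := by field_simp

theorem exists_excision_family {ι : Type*} [Finite ι] {r : B} (hr : IsLocalUnit r) (f : ι → B)
    {ε : ℝ} (hε : 0 < ε) : ∃ s : B, IsLocalUnit s ∧ r * s = s ∧ ∃ μ : ι → ℂ, ∀ i, ∀ a : B,
      s * a = a → ‖star a * f i * a - μ i • (star a * a)‖ ≤ ε * ‖a‖ ^ 2 := by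
  classical
  have := Fintype.ofFinite ι
  suffices H : ∀ T : Finset ι, ∃ s : B, IsLocalUnit s ∧ r * s = s ∧ ∀ i ∈ T, ∃ μ : ℂ, ∀ a : B,
      s * a = a → ‖star a * f i * a - μ • (star a * a)‖ ≤ ε * ‖a‖ ^ 2 by
    obtain ⟨s, hs, hrs, h⟩ := H Finset.univ
    choose μ hμ using fun i => h i (Finset.mem_univ i)
    exact ⟨s, hs, hrs, μ, hμ⟩
  intro T
  induction T using Finset.induction_on with
  | empty =>
    obtain ⟨s, hs, hrs⟩ := hr.exists_mul_eq
    exact ⟨s, hs, hrs, by simp⟩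
  | insert i T _ ih =>
    obtain ⟨s, hs, hrs, h⟩ := ih
    obtain ⟨s', hs', hss', μ, hμ⟩ := exists_excision hs (f i) hε
    refine ⟨s', hs', by rw [← hss', ← mul_assoc, hrs], fun j hj => ?_⟩
    rcases Finset.mem_insert.1 hj with rfl | hj
    · exact ⟨μ, hμ⟩
    · obtain ⟨μ', h'⟩ := h j hj
      exact ⟨μ', fun a ha => h' a (by rw [← ha, ← mul_assoc, hss'])⟩

end PositiveElements

/-! ### Every C⋆-norm on the algebraic tensor product is a cross norm. -/

section TensorMaps

theorem mul_self_nonneg_and_le_norm_smul {E : Type*} [NonUnitalCStarAlgebra E] [PartialOrder E]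
    [StarOrderedRing E] {x : E} (hx : 0 ≤ x) : 0 ≤ x * x ∧ x * x ≤ ‖x‖ • x := by
  have hsa : IsSelfAdjoint x := .of_nonneg hx
  constructor
  · simpa only [hsa.star_eq] using star_mul_self_nonneg x
  · have e1 : x * x = cfcₙ (fun t : ℝ => t * t) x := by
      rw [cfcₙ_mul (fun t : ℝ => t) (fun t => t) x, cfcₙ_id' ℝ x]
    have e2 : ‖x‖ • x = cfcₙ (fun t : ℝ => ‖x‖ * t) x := by
      rw [cfcₙ_const_mul_id ‖x‖ x]
    rw [e1, e2]
    refine cfcₙ_mono fun t ht => ?_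
    have h1 := norm_apply_le_norm_cfcₙ (fun t : ℝ => t) x ht
    rw [cfcₙ_id' ℝ x, Real.norm_eq_abs] at h1
    exact mul_le_mul_of_nonneg_right ((le_abs_self t).trans h1)
      (quasispectrum_nonneg_of_nonneg x hx t ht)

variable {B C D : Type*}

/-- A bilinear map of C⋆-algebras with the algebraic properties of the canonical map
`B × C → B ⊗_ν C`. -/
structure IsCStarTensorMap [NonUnitalCStarAlgebra B] [NonUnitalCStarAlgebra C]
    [NonUnitalCStarAlgebra D] (τ : B →ₗ[ℂ] C →ₗ[ℂ] D) : Prop where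
  map_mul : ∀ b b' c c', τ (b * b') (c * c') = τ b c * τ b' c'
  map_star : ∀ b c, τ (star b) (star c) = star (τ b c)
  ne_zero : ∀ b c, b ≠ 0 → c ≠ 0 → τ b c ≠ 0

namespace IsCStarTensorMap

variable [NonUnitalCStarAlgebra B] [PartialOrder B] [StarOrderedRing B]
  [NonUnitalCStarAlgebra C] [PartialOrder C] [StarOrderedRing C]
  [NonUnitalCStarAlgebra D] [PartialOrder D] [StarOrderedRing D]
  {τ : B →ₗ[ℂ] C →ₗ[ℂ] D} (hτ : IsCStarTensorMap τ)

include hτ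

theorem map_nonneg {b : B} {c : C} (hb : 0 ≤ b) (hc : 0 ≤ c) : 0 ≤ τ b c := by
  obtain ⟨x, rfl⟩ := CStarAlgebra.nonneg_iff_eq_star_mul_self.1 hb
  obtain ⟨y, rfl⟩ := CStarAlgebra.nonneg_iff_eq_star_mul_self.1 hc
  rw [hτ.map_mul, hτ.map_star]
  exact star_mul_self_nonneg _

theorem map_le_map {b b' : B} {c c' : C} (hb : b ≤ b') (hc : c ≤ c') (hb' : 0 ≤ b') (h0 : 0 ≤ c) :
    τ b c ≤ τ b' c' := by
  have h1 := hτ.map_nonneg (sub_nonneg.2 hb) h0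
  have h2 := hτ.map_nonneg hb' (sub_nonneg.2 hc)
  rw [map_sub, LinearMap.sub_apply, sub_nonneg] at h1
  rw [map_sub, sub_nonneg] at h2
  exact h1.trans h2

/-- From `x * x ≤ ‖x‖ • x` in each factor, the square of `τ b c` is at most `(‖b‖ * ‖c‖) • τ b c`;
take norms and cancel. -/
theorem norm_map_le_of_nonneg {b : B} {c : C} (hb : 0 ≤ b) (hc : 0 ≤ c) :
    ‖τ b c‖ ≤ ‖b‖ * ‖c‖ := by
  have hbc := hτ.map_nonneg hb hc
  have h1 : τ b c * τ b c ≤ (‖b‖ * ‖c‖) • τ b c := by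
    rw [← hτ.map_mul]
    have e : τ (‖b‖ • b) (‖c‖ • c) = (‖b‖ * ‖c‖) • τ b c := by
      rw [LinearMap.map_smul_of_tower, LinearMap.map_smul_of_tower, LinearMap.smul_apply,
        smul_comm, mul_smul]
    refine (hτ.map_le_map (mul_self_nonneg_and_le_norm_smul hb).2 (mul_self_nonneg_and_le_norm_smul hc).2 (smul_nonneg (norm_nonneg _) hb)
      (mul_self_nonneg_and_le_norm_smul hc).1).trans_eq e
  have h2 := CStarAlgebra.norm_le_norm_of_nonneg_of_le (mul_self_nonneg_and_le_norm_smul hbc).1 h1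
  rw [norm_smul, Real.norm_of_nonneg (by positivity)] at h2
  have h3 := CStarRing.norm_star_mul_self (x := τ b c)
  rw [(IsSelfAdjoint.of_nonneg hbc).star_eq] at h3
  rw [h3] at h2
  rcases (norm_nonneg (τ b c)).eq_or_lt with h0 | h0
  · rw [← h0]; positivity
  · exact le_of_mul_le_mul_right h2 h0

/-- Spectral cuts `r`, `s` at levels `k < ‖b‖`, `l < ‖c‖` make the compression of `τ b c` by `τ r s`
dominate `k * l` times the square of `τ r s`, which is nonzero and cancels in norm. -/
theorem le_norm_map_of_nonneg {b : B} {c : C} (hb : 0 ≤ b) (hc : 0 ≤ c) :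
    ‖b‖ * ‖c‖ ≤ ‖τ b c‖ := by
  have key : ∀ k l : ℝ, 0 ≤ k → 0 ≤ l → k < ‖b‖ → l < ‖c‖ → k * l ≤ ‖τ b c‖ := by
    intro k l hk hl hkb hlc
    obtain ⟨r, hr, hr0, hrb⟩ := exists_smul_mul_self_le_conjugate hb hk hkb
    obtain ⟨s, hs, hs0, hsc⟩ := exists_smul_mul_self_le_conjugate hc hl hlc
    have hrs : star r = r := (IsSelfAdjoint.of_nonneg hr).star_eq
    have hss : star s = s := (IsSelfAdjoint.of_nonneg hs).star_eq
    have hrr : 0 ≤ r * r := by simpa only [hrs] using star_mul_self_nonneg r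
    have hss' : 0 ≤ s * s := by simpa only [hss] using star_mul_self_nonneg s
    have h1 := hτ.map_le_map hrb hsc ((smul_nonneg hk hrr).trans hrb) (smul_nonneg hl hss')
    have h2 := CStarAlgebra.norm_le_norm_of_nonneg_of_le
      (hτ.map_nonneg (smul_nonneg hk hrr) (smul_nonneg hl hss')) h1
    have e1 : τ (k • (r * r)) (l • (s * s)) = (k * l) • (star (τ r s) * τ r s) := by
      rw [← hτ.map_star, hrs, hss, ← hτ.map_mul, LinearMap.map_smul_of_tower,
        LinearMap.map_smul_of_tower, LinearMap.smul_apply, smul_comm, mul_smul]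
    have e2 : τ (r * b * r) (s * c * s) = τ r s * τ b c * τ r s := by
      rw [hτ.map_mul, hτ.map_mul]
    rw [e1, e2, norm_smul, CStarRing.norm_star_mul_self, Real.norm_of_nonneg (by positivity)] at h2
    have h3 : ‖τ r s * τ b c * τ r s‖ ≤ ‖τ r s‖ * ‖τ b c‖ * ‖τ r s‖ :=
      (norm_mul_le _ _).trans (by gcongr; exact norm_mul_le _ _)
    have h4 : 0 < ‖τ r s‖ * ‖τ r s‖ := by
      have := norm_pos_iff.2 (hτ.ne_zero r s hr0 hs0)
      positivity
    refine le_of_mul_le_mul_right (h2.trans (h3.trans_eq ?_)) h4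
    ring
  rcases (norm_nonneg b).eq_or_lt with h | hb'
  · rw [← h, zero_mul]; positivity
  rcases (norm_nonneg c).eq_or_lt with h | hc'
  · rw [← h, mul_zero]; positivity
  by_contra! h
  obtain ⟨k, hk1, hk⟩ := exists_between ((div_lt_iff₀ hc').2 h)
  have hk0 : 0 < k := lt_of_le_of_lt (by positivity) hk1
  obtain ⟨l, hl1, hl⟩ := exists_between ((div_lt_iff₀' hk0).2 ((div_lt_iff₀ hc').1 hk1))
  have := key k l hk0.le (le_trans (by positivity) hl1.le) hk hl
  rw [div_lt_iff₀' hk0] at hl1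
  linarith

theorem norm_map (b : B) (c : C) : ‖τ b c‖ = ‖b‖ * ‖c‖ := by
  have h1 : ‖τ (star b * b) (star c * c)‖ = ‖star b * b‖ * ‖star c * c‖ :=
    le_antisymm
      (hτ.norm_map_le_of_nonneg (star_mul_self_nonneg b) (star_mul_self_nonneg c))
      (hτ.le_norm_map_of_nonneg (star_mul_self_nonneg b) (star_mul_self_nonneg c))
  rw [hτ.map_mul, hτ.map_star] at h1
  simp only [CStarRing.norm_star_mul_self] at h1
  rw [mul_mul_mul_comm] at h1
  exact (mul_self_inj (norm_nonneg _) (by positivity)).1 h1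

end IsCStarTensorMap

end TensorMaps

/-! ### The canonical bilinear map into the completion. -/

namespace CStarNorm

variable {B C : Type*} [NonUnitalCStarAlgebra B] [NonUnitalCStarAlgebra C]
  (ν : CStarNorm (B ⊗[ℂ] C))

/-- The canonical bilinear map from `B × C` to `B ⊗_ν C`. -/
def tmul : B →ₗ[ℂ] C →ₗ[ℂ] CStarTensorProduct B C ν :=
  LinearMap.compr₂ (TensorProduct.mk ℂ B C) (show B ⊗[ℂ] C →ₗ[ℂ] _ from (Completion.coe ν).toLinearMap)

theorem tmul_apply (b : B) (c : C) : ν.tmul b c = Completion.coe ν (b ⊗ₜ[ℂ] c : B ⊗[ℂ] C) := rfl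

theorem isCStarTensorMap_tmul : IsCStarTensorMap ν.tmul where
  map_mul b b' c c' := by
    have h := Completion.coe_mul ν (b ⊗ₜ[ℂ] c : B ⊗[ℂ] C) (b' ⊗ₜ[ℂ] c' : B ⊗[ℂ] C)
    exact (congrArg (Completion.coe ν)
      (Algebra.TensorProduct.tmul_mul_tmul b b' c c').symm).trans h
  map_star b c := by
    exact (congrArg (Completion.coe ν) (TensorProduct.star_tmul b c).symm).trans
      (Completion.coe_star ν (b ⊗ₜ[ℂ] c : B ⊗[ℂ] C))
  ne_zero b c hb hc h := by
    rw [tmul_apply] at h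
    have h0 : (b ⊗ₜ[ℂ] c : B ⊗[ℂ] C) = 0 :=
      (Completion.coe ν).injective (h.trans (map_zero (Completion.coe ν)).symm)
    -- Algebraic functionals suffice to detect a nonzero elementary tensor.
    obtain ⟨f, hf⟩ := not_forall.1 (mt (Module.forall_dual_apply_eq_zero_iff ℂ b).1 hb)
    obtain ⟨g, hg⟩ := not_forall.1 (mt (Module.forall_dual_apply_eq_zero_iff ℂ c).1 hc)
    have h1 := congrArg (LinearMap.mul' ℂ ℂ ∘ₗ TensorProduct.map f g) h0
    simp only [LinearMap.comp_apply, TensorProduct.map_tmul, LinearMap.mul'_apply, map_zero] at h1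
    exact (mul_ne_zero hf hg) h1

theorem exists_norm_sub_sum_tmul_lt (z : CStarTensorProduct B C ν) {ε : ℝ} (hε : 0 < ε) :
    ∃ S : Finset (B × C), ‖z - ∑ i ∈ S, ν.tmul i.1 i.2‖ < ε := by
  obtain ⟨t, ht⟩ := (Completion.denseRange_coe ν).exists_dist_lt z hε
  obtain ⟨S, hS⟩ := TensorProduct.exists_finset (R := ℂ) (M := B) (N := C) t
  refine ⟨S, ?_⟩
  have h : Completion.coe ν t = ∑ i ∈ S, ν.tmul i.1 i.2 := by
    rw [hS]
    exact map_sum (Completion.coe ν) _ _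
  rwa [← h, ← dist_eq_norm]

end CStarNorm

/-! ### Orthogonal sequences in infinite-dimensional C⋆-algebras. -/

section OrthogonalSequences

variable {B : Type*} [NonUnitalCStarAlgebra B] [PartialOrder B] [StarOrderedRing B]

variable (B) in
/-- The existence of an infinite sequence of nonzero pairwise orthogonal positive elements. -/
def HasOrthogonalSequence : Prop :=
  ∃ b : ℕ → B, (∀ n, 0 ≤ b n ∧ b n ≠ 0) ∧ Pairwise fun m n => b m * b n = 0

theorem hasOrthogonalSequence_of_infinite_quasispectrum {g : B} (hg : IsSelfAdjoint g)
    (hinf : (quasispectrum ℝ g).Infinite) : HasOrthogonalSequence B := by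
  set T : Set ℝ := quasispectrum ℝ g \ {0}
  have hT : T.Infinite := hinf.sdiff (Set.finite_singleton 0)
  have : Infinite T := hT.to_subtype
  obtain ⟨U, hU, hUo, hUd⟩ := exists_seq_infinite_isOpen_pairwise_disjoint T
  choose x hx using fun n => (hU n).nonempty
  choose ε hε hball using fun n => Metric.isOpen_iff.1 (hUo n) (x n) (hx n)
  -- Tent functions over disjoint open pieces of the spectrum; capping the radius at `|x n|` forces
  -- `f n 0 = 0`, as the non-unital calculus demands.
  set f : ℕ → ℝ → ℝ := fun n t => max 0 (min (ε n) |(x n : ℝ)| - |t - x n|) with hf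
  have hfc : ∀ n, Continuous (f n) := fun n => by fun_prop
  have hf0 : ∀ n, f n 0 = 0 := fun n => by
    refine max_eq_left ?_
    rw [zero_sub, abs_neg]
    linarith [min_le_right (ε n) |(x n : ℝ)|]
  have hmem : ∀ n (t : ℝ) (ht : t ∈ quasispectrum ℝ g), f n t ≠ 0 → ∃ h : t ∈ T, ⟨t, h⟩ ∈ U n := by
    intro n t ht hft
    have ht0 : t ≠ 0 := by rintro rfl; exact hft (hf0 n)
    refine ⟨⟨ht, ht0⟩, hball n ?_⟩
    have h1 : 0 < min (ε n) |(x n : ℝ)| - |t - x n| := by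
      by_contra! h
      exact hft (max_eq_left h)
    rw [Metric.mem_ball, Subtype.dist_eq, Real.dist_eq]
    linarith [min_le_left (ε n) |(x n : ℝ)|]
  refine ⟨fun n => cfcₙ (f n) g, fun n => ⟨cfcₙ_nonneg fun t _ => le_max_left _ _, fun h => ?_⟩,
    fun m n hmn => ?_⟩
  · rw [← cfcₙ_zero ℝ g] at h
    have h1 := eqOn_of_cfcₙ_eq_cfcₙ h hg (hfc n).continuousOn (hf0 n) continuousOn_const rfl
      (x n).2.1
    have h2 : 0 < min (ε n) |(x n : ℝ)| := lt_min (hε n) (abs_pos.2 (x n).2.2)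
    simp only [hf, sub_self, abs_zero, sub_zero, Pi.zero_apply] at h1
    rw [max_eq_right h2.le] at h1
    exact h2.ne' h1
  · change cfcₙ (f m) g * cfcₙ (f n) g = 0
    rw [← cfcₙ_mul (f m) (f n) g (hfc m).continuousOn (hf0 m) (hfc n).continuousOn (hf0 n),
      ← cfcₙ_zero ℝ g]
    refine cfcₙ_congr fun t ht => ?_
    by_contra h
    obtain ⟨h1, h2⟩ := mul_ne_zero_iff.1 h
    obtain ⟨ht1, hm⟩ := hmem m t ht h1
    obtain ⟨_, hn⟩ := hmem n t ht h2
    exact Set.disjoint_left.1 (hUd hmn) hm hn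

/-- The spectrum is now finite, so indicator functions of its points are continuous on it. -/
theorem exists_spectral_projection (hB : ¬ HasOrthogonalSequence B) {g : B} (hg : 0 ≤ g)
    (hg0 : g ≠ 0) : ∃ p : B, IsStarProjection p ∧ p ≠ 0 ∧ (∃ y, p = g * y) ∧
      ∃ x : ℝ, x ≠ 0 ∧ g * p = x • p := by
  obtain ⟨x, hx, hx0⟩ := exists_pos_mem_quasispectrum hg hg0
  have hsa : IsSelfAdjoint g := .of_nonneg hg
  have hfin : (quasispectrum ℝ g).Finite := by
    by_contra h
    exact hB (hasOrthogonalSequence_of_infinite_quasispectrum hsa h)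
  have hc : ∀ f : ℝ → ℝ, ContinuousOn f (quasispectrum ℝ g) := fun f => hfin.continuousOn f
  set f : ℝ → ℝ := fun t => if t = x then 1 else 0 with hf
  set k : ℝ → ℝ := fun t => if t = x then x⁻¹ else 0 with hk
  have hf0 : f 0 = 0 := if_neg hx0.ne
  have hk0 : k 0 = 0 := if_neg hx0.ne
  refine ⟨cfcₙ f g, ⟨?_, cfcₙ_predicate f g⟩, ?_, ⟨cfcₙ k g, ?_⟩, x, hx0.ne', ?_⟩
  · rw [IsIdempotentElem, ← cfcₙ_mul f f g (hc f) hf0 (hc f) hf0]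
    refine cfcₙ_congr fun t _ => ?_
    by_cases h : t = x <;> simp [hf, h]
  · intro h
    rw [← cfcₙ_zero ℝ g] at h
    have := eqOn_of_cfcₙ_eq_cfcₙ h hsa (hc f) hf0 continuousOn_const rfl hx
    simp [hf] at this
  · conv_rhs => enter [1]; rw [← cfcₙ_id' ℝ g]
    rw [← cfcₙ_mul (fun t => t) k g continuousOn_id rfl (hc k) hk0]
    refine cfcₙ_congr fun t _ => ?_
    by_cases h : t = x
    · simp [hf, hk, h, hx0.ne']
    · simp [hf, hk, h]
  · conv_lhs => enter [1]; rw [← cfcₙ_id' ℝ g]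
    rw [← cfcₙ_mul (fun t => t) f g continuousOn_id rfl (hc f) hf0,
      ← cfcₙ_smul x f g (hc f) hf0]
    refine cfcₙ_congr fun t _ => ?_
    by_cases h : t = x <;> simp [hf, h]

theorem hasOrthogonalSequence_of_projections {d : ℕ → B} (hd : ∀ n, IsStarProjection (d n))
    (hd0 : ∀ n, d n ≠ 0) (h : ∀ m n, m < n → d m * d n = 0) : HasOrthogonalSequence B := by
  refine ⟨d, fun n => ⟨(hd n).nonneg, hd0 n⟩, fun m n hmn => ?_⟩
  rcases hmn.lt_or_gt with hlt | hlt
  · exact h m n hlt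
  · have := congrArg star (h n m hlt)
    rwa [star_mul, (hd n).isSelfAdjoint.star_eq, (hd m).isSelfAdjoint.star_eq, star_zero] at this

/-- Strict inequality of projections. -/
def ProjLT (q p : B) : Prop :=
  IsStarProjection q ∧ IsStarProjection p ∧ p * q = q ∧ q ≠ p

omit [PartialOrder B] [StarOrderedRing B] in
theorem ProjLT.mul_eq_left {q p : B} (h : ProjLT q p) : q * p = q := by
  have := congrArg star h.2.2.1
  rwa [star_mul, h.1.isSelfAdjoint.star_eq, h.2.1.isSelfAdjoint.star_eq] at this

omit [PartialOrder B] [StarOrderedRing B] in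
theorem ProjLT.isStarProjection_sub {q p : B} (h : ProjLT q p) : IsStarProjection (p - q) :=
  h.1.sub_of_mul_eq_left h.2.1 h.mul_eq_left

/-- Successive differences along an infinite strict chain of projections are nonzero and orthogonal.
-/
theorem wellFounded_projLT (hB : ¬ HasOrthogonalSequence B) :
    WellFounded (ProjLT : B → B → Prop) := by
  rw [wellFounded_iff_isEmpty_descending_chain]
  refine ⟨fun ⟨u, hu⟩ => hB (hasOrthogonalSequence_of_projections (d := fun n => u n - u (n + 1))
    (fun n => (hu n).isStarProjection_sub) (fun n => sub_ne_zero.2 (hu n).2.2.2.symm) ?_)⟩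
  have h1 : ∀ m k, u m * u (m + k) = u (m + k) := by
    intro m k
    induction k with
    | zero => exact (hu m).2.1.isIdempotentElem
    | succ k ih => rw [← add_assoc, ← (hu (m + k)).2.2.1, ← mul_assoc, ih]
  have h2 : ∀ m n, m ≤ n → u m * u n = u n := fun m n h => by
    obtain ⟨k, rfl⟩ := Nat.exists_eq_add_of_le h
    exact h1 m k
  intro m n hmn
  rw [sub_mul, mul_sub, mul_sub, h2 m n hmn.le, h2 m (n + 1) (by omega), h2 (m + 1) n hmn,
    h2 (m + 1) (n + 1) (by omega), sub_self]

theorem wellFounded_projGT (hB : ¬ HasOrthogonalSequence B) :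
    WellFounded (fun p q : B => ProjLT q p) := by
  rw [wellFounded_iff_isEmpty_descending_chain]
  refine ⟨fun ⟨u, hu⟩ => hB (hasOrthogonalSequence_of_projections (d := fun n => u (n + 1) - u n)
    (fun n => (hu n).isStarProjection_sub) (fun n => sub_ne_zero.2 (hu n).2.2.2.symm) ?_)⟩
  have h1 : ∀ m k, u m * u (m + k) = u m := by
    intro m k
    induction k with
    | zero => exact (hu m).1.isIdempotentElem
    | succ k ih =>
      conv_lhs => rw [← ih]
      rw [mul_assoc, ← add_assoc, (hu (m + k)).mul_eq_left, ih]
  have h2 : ∀ m n, m ≤ n → u m * u n = u m := fun m n h => by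
    obtain ⟨k, rfl⟩ := Nat.exists_eq_add_of_le h
    exact h1 m k
  intro m n hmn
  rw [sub_mul, mul_sub, mul_sub, h2 m n hmn.le, h2 m (n + 1) (by omega), h2 (m + 1) n hmn,
    h2 (m + 1) (n + 1) (by omega), sub_self, sub_self, sub_self]

/-- A maximal projection is a left unit: a nonzero `c = b - p * b` would give a spectral projection
of `c * star c` orthogonal to `p`, which enlarges `p`. -/
theorem exists_projection_mul_eq_self (hB : ¬ HasOrthogonalSequence B) :
    ∃ p : B, IsStarProjection p ∧ ∀ b, p * b = b := by
  obtain ⟨p, hp, hmax⟩ := (wellFounded_projGT hB).has_min {p : B | IsStarProjection p}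
    ⟨0, .zero B⟩
  refine ⟨p, hp, fun b => ?_⟩
  by_contra hb
  set c := b - p * b with hc
  have hpc : p * c = 0 := by
    rw [hc, mul_sub, ← mul_assoc, hp.isIdempotentElem.eq, sub_self]
  have hc0 : c ≠ 0 := sub_ne_zero.2 (Ne.symm hb)
  obtain ⟨e, he, he0, ⟨y, hy⟩, -⟩ := exists_spectral_projection hB (mul_star_self_nonneg c)
    (CStarRing.mul_star_self_ne_zero_iff c |>.2 hc0)
  have hpe : p * e = 0 := by
    rw [hy, ← mul_assoc, ← mul_assoc, hpc, zero_mul, zero_mul]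
  have hep := hp.add he hpe
  refine hmax (p + e) hep ⟨hp, hep, ?_, ?_⟩
  · have : e * p = 0 := by
      have := congrArg star hpe
      rwa [star_mul, hp.isSelfAdjoint.star_eq, he.isSelfAdjoint.star_eq, star_zero] at this
    rw [add_mul, hp.isIdempotentElem.eq, this, add_zero]
  · simpa using he0

/-- A nonzero projection without proper nonzero subprojections. -/
structure IsMinimalProjection (q : B) : Prop where
  isStarProjection : IsStarProjection q
  ne_zero : q ≠ 0
  eq_of_mul_eq : ∀ e : B, IsStarProjection e → q * e = e → e ≠ 0 → e = q

theorem projection_induction (hB : ¬ HasOrthogonalSequence B) {Q : B → Prop} (h0 : Q 0)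
    (hmin : ∀ q, IsMinimalProjection q → Q q) (hadd : ∀ e f, Q e → Q f → Q (e + f)) {p : B}
    (hp : IsStarProjection p) : Q p := by
  induction p using (wellFounded_projLT hB).induction with
  | _ p ih =>
    by_cases hp0 : p = 0
    · rwa [hp0]
    by_cases hpm : IsMinimalProjection p
    · exact hmin p hpm
    have : ∃ e : B, IsStarProjection e ∧ p * e = e ∧ e ≠ 0 ∧ e ≠ p := by
      by_contra! h
      exact hpm ⟨hp, hp0, h⟩
    obtain ⟨e, he, hpe, he0, hep⟩ := this
    have hlt : ProjLT e p := ⟨he, hp, hpe, hep⟩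
    have hsub := hlt.isStarProjection_sub
    have h1 := ih e hlt he
    have h2 := ih (p - e) ⟨hsub, hp, by rw [mul_sub, hpe, hp.isIdempotentElem.eq],
      by simpa using he0⟩ hsub
    simpa using hadd e (p - e) h1 h2

theorem IsMinimalProjection.exists_eq_smul_of_nonneg (hB : ¬ HasOrthogonalSequence B) {q g : B}
    (hq : IsMinimalProjection q) (hg : 0 ≤ g) (hqg : q * g = g) (hg0 : g ≠ 0) :
    ∃ c : ℝ, c ≠ 0 ∧ g = c • q := by
  obtain ⟨p, hp, hp0, ⟨y, hy⟩, x, hx, hgp⟩ := exists_spectral_projection hB hg hg0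
  obtain rfl : p = q := hq.eq_of_mul_eq p hp (by rw [hy, ← mul_assoc, hqg]) hp0
  refine ⟨x, hx, ?_⟩
  rw [← hgp]
  have := congrArg star hqg
  rwa [star_mul, (IsSelfAdjoint.of_nonneg hg).star_eq, hp.isSelfAdjoint.star_eq, eq_comm] at this

theorem IsMinimalProjection.exists_corner_eq_smul (hB : ¬ HasOrthogonalSequence B) {q : B}
    (hq : IsMinimalProjection q) (b : B) : ∃ μ : ℂ, q * b * q = μ • q := by
  have hb : b ∈ Submodule.span ℂ {a : B | 0 ≤ a} := by
    rw [CStarAlgebra.span_nonneg]; trivial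
  have hqq : q * q = q := hq.isStarProjection.isIdempotentElem
  induction hb using Submodule.span_induction with
  | mem x hx =>
    by_cases h0 : q * x * q = 0
    · exact ⟨0, by rw [h0, zero_smul]⟩
    have hnn : 0 ≤ q * x * q := by
      have := star_left_conjugate_nonneg hx q
      rwa [hq.isStarProjection.isSelfAdjoint.star_eq] at this
    obtain ⟨c, -, hc⟩ := hq.exists_eq_smul_of_nonneg hB hnn (by simp only [← mul_assoc, hqq]) h0
    exact ⟨c, by rw [hc, Complex.coe_smul]⟩
  | zero => exact ⟨0, by simp⟩
  | add x y _ _ hx hy =>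
    obtain ⟨μ, hμ⟩ := hx
    obtain ⟨μ', hμ'⟩ := hy
    exact ⟨μ + μ', by rw [mul_add, add_mul, hμ, hμ', add_smul]⟩
  | smul c x _ hx =>
    obtain ⟨μ, hμ⟩ := hx
    exact ⟨c * μ, by rw [mul_smul_comm, smul_mul_assoc, hμ, mul_smul]⟩

/-- The compression `b ↦ r b q`. -/
def cornerMap (r q : B) : B →ₗ[ℂ] B :=
  LinearMap.mulRight ℂ q ∘ₗ LinearMap.mulLeft ℂ r

omit [PartialOrder B] [StarOrderedRing B] in
theorem cornerMap_apply (r q b : B) : cornerMap r q b = r * b * q := rfl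

/-- The corner `r B q` has dimension at most one: if `y ≠ 0` lies in it, then `star y * y = c • q`,
so `c • (r x q) = (r x q * star y) * y`, and the bracket is a scalar multiple of `r`. -/
theorem IsMinimalProjection.finiteDimensional_range_cornerMap (hB : ¬ HasOrthogonalSequence B)
    {r q : B} (hr : IsMinimalProjection r) (hq : IsMinimalProjection q) :
    FiniteDimensional ℂ (LinearMap.range (cornerMap r q)) := by
  have hqq : q * q = q := hq.isStarProjection.isIdempotentElem
  have hrr : r * r = r := hr.isStarProjection.isIdempotentElem
  have hqs : star q = q := hq.isStarProjection.isSelfAdjoint.star_eq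
  by_cases h : ∀ b, r * b * q = 0
  · have : cornerMap r q = 0 := LinearMap.ext h
    rw [this, LinearMap.range_zero]
    infer_instance
  push Not at h
  obtain ⟨b, hb⟩ := h
  set y := r * b * q with hy
  have hyq : y * q = y := by rw [hy, mul_assoc, hqq]
  have hry : r * y = y := by rw [hy, ← mul_assoc, ← mul_assoc, hrr]
  have hyr : star y * r = star y := by
    have := congrArg star hry
    rwa [star_mul, hr.isStarProjection.isSelfAdjoint.star_eq] at this
  obtain ⟨c, hc, hyc⟩ := hq.exists_eq_smul_of_nonneg hB (star_mul_self_nonneg y)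
    (by conv_rhs => rw [← hyq, star_mul, hqs, mul_assoc, hyq])
    (CStarRing.star_mul_self_ne_zero_iff y |>.2 hb)
  refine Submodule.finiteDimensional_of_le (S₂ := Submodule.span ℂ {y}) ?_
  rintro _ ⟨x, rfl⟩
  rw [cornerMap_apply]
  obtain ⟨μ, hμ⟩ := hr.exists_corner_eq_smul hB (x * q * star y)
  have h1 : r * x * q * star y = μ • r := by
    rw [← hμ]
    simp only [mul_assoc, hyr]
  have h2 : c • (r * x * q) = μ • y := by
    calc c • (r * x * q) = r * x * q * (c • q) := by rw [mul_smul_comm, mul_assoc _ q q, hqq]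
      _ = r * x * q * star y * y := by rw [← hyc, ← mul_assoc]
      _ = μ • y := by rw [h1, smul_mul_assoc, hry]
  refine Submodule.mem_span_singleton.2 ⟨(c : ℂ)⁻¹ * μ, ?_⟩
  rw [mul_smul, ← h2, ← Complex.coe_smul c, inv_smul_smul₀ (by exact_mod_cast hc)]

omit [PartialOrder B] [StarOrderedRing B] in
theorem finiteDimensional_range_add {f g : B →ₗ[ℂ] B}
    (hf : FiniteDimensional ℂ (LinearMap.range f)) (hg : FiniteDimensional ℂ (LinearMap.range g)) :
    FiniteDimensional ℂ (LinearMap.range (f + g)) := by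
  refine Submodule.finiteDimensional_of_le (S₂ := LinearMap.range f ⊔ LinearMap.range g) ?_
  rintro _ ⟨x, rfl⟩
  exact Submodule.add_mem_sup ⟨x, rfl⟩ ⟨x, rfl⟩

/-- An infinite-dimensional C⋆-algebra contains an infinite sequence of nonzero pairwise orthogonal
positive elements. -/
theorem hasOrthogonalSequence_of_not_finiteDimensional (hdim : ¬ FiniteDimensional ℂ B) :
    HasOrthogonalSequence B := by
  -- The algebra equals `p B p` for a unit `p`. Splitting each copy of `p` into minimal projections
  -- leaves finitely many finite-dimensional corners.
  by_contra hB
  have hfin0 : FiniteDimensional ℂ (LinearMap.range (0 : B →ₗ[ℂ] B)) := by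
    rw [LinearMap.range_zero]; infer_instance
  have h1 : ∀ q : B, IsMinimalProjection q → ∀ r : B, IsStarProjection r →
      FiniteDimensional ℂ (LinearMap.range (cornerMap r q)) := by
    intro q hq r hr
    refine projection_induction hB
      (Q := fun r => FiniteDimensional ℂ (LinearMap.range (cornerMap r q))) ?_
      (fun r hr => hr.finiteDimensional_range_cornerMap hB hq) (fun e f he hf => ?_) hr
    · have : cornerMap 0 q = 0 := LinearMap.ext fun b => by simp [cornerMap_apply]
      rwa [this]
    · have : cornerMap (e + f) q = cornerMap e q + cornerMap f q :=
        LinearMap.ext fun b => by simp [cornerMap_apply, add_mul]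
      rw [this]
      exact finiteDimensional_range_add he hf
  have h2 : ∀ r q : B, IsStarProjection r → IsStarProjection q →
      FiniteDimensional ℂ (LinearMap.range (cornerMap r q)) := by
    intro r q hr hq
    refine projection_induction hB
      (Q := fun q => FiniteDimensional ℂ (LinearMap.range (cornerMap r q))) ?_
      (fun q hq => h1 q hq r hr) (fun e f he hf => ?_) hq
    · have : cornerMap r 0 = 0 := LinearMap.ext fun b => by simp [cornerMap_apply]
      rwa [this]
    · have : cornerMap r (e + f) = cornerMap r e + cornerMap r f :=
        LinearMap.ext fun b => by simp [cornerMap_apply, mul_add]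
      rw [this]
      exact finiteDimensional_range_add he hf
  obtain ⟨p, hp, hpb⟩ := exists_projection_mul_eq_self hB
  have h3 : cornerMap p p = LinearMap.id := LinearMap.ext fun b => by
    have := congrArg star (hpb (star b))
    rw [star_mul, star_star, hp.isSelfAdjoint.star_eq] at this
    rw [cornerMap_apply, hpb, this, LinearMap.id_apply]
  have h4 := h2 p p hp hp
  rw [h3, LinearMap.range_id] at h4
  exact hdim (Module.finite_def.2 (Module.Finite.iff_fg.1 h4))

end OrthogonalSequences

/-! ### The separating element and the contradiction. -/

section Nonfactorizability

theorem HasOrthogonalSequence.exists_isLocalUnit {B : Type*} [NonUnitalCStarAlgebra B]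
    [PartialOrder B] [StarOrderedRing B] (hB : HasOrthogonalSequence B) :
    ∃ s : ℕ → B, (∀ n, IsLocalUnit (s n)) ∧ ∀ m n, m ≠ n → s m * s n = 0 := by
  obtain ⟨b, hb, hort⟩ := hB
  choose s hs y hy using fun n => exists_isLocalUnit_eq_mul (hb n).1 (hb n).2
  refine ⟨s, hs, fun m n hmn => ?_⟩
  have h1 : s m = star (y m) * b m := by
    have := congrArg star (hy m)
    rwa [star_mul, (IsSelfAdjoint.of_nonneg (hs m).nonneg).star_eq,
      (IsSelfAdjoint.of_nonneg (hb m).1).star_eq] at this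
  have h2 : b m * b n = 0 := hort hmn
  rw [h1, hy n, mul_assoc, ← mul_assoc (b m), h2, zero_mul, mul_zero]

/-- In a SAW⋆-algebra, any set of members of a sequence of orthogonal positive contractions can be
separated from the remaining members. -/
theorem IsSAWStarAlgebra.exists_separating {D : Type*} [NonUnitalCStarAlgebra D] [PartialOrder D]
    [StarOrderedRing D] (hD : IsSAWStarAlgebra D) {u : ℕ × ℕ → D} (hu : ∀ p, 0 ≤ u p)
    (hu1 : ∀ p, ‖u p‖ ≤ 1) (hort : ∀ p q, p ≠ q → u p * u q = 0) (J : Set (ℕ × ℕ)) :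
    ∃ e : D, ∀ p z, u p * z = z → (p ∈ J → e * z = z) ∧ (p ∉ J → e * z = 0) := by
  classical
  -- Summable positive weights: the sums over `J` and `Jᶜ` converge to orthogonal positive elements.
  -- Multiplying by a `z` fixed by `u p` isolates one term, whose weight then cancels.
  set w : ℕ × ℕ → ℝ := fun p => (1 / 2) ^ p.1 * (1 / 2) ^ p.2 with hw
  have hw0 : ∀ p, 0 < w p := fun p => by positivity
  have hws : Summable w := summable_geometric_two.mul_of_nonneg summable_geometric_two
    (fun _ => by positivity) (fun _ => by positivity)
  set v : Set (ℕ × ℕ) → ℕ × ℕ → D := fun J p => if p ∈ J then w p • u p else 0 with hv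
  have hvs : ∀ J, Summable (v J) := fun J => by
    refine Summable.of_norm_bounded hws fun p => ?_
    by_cases h : p ∈ J
    · simp only [hv, if_pos h, norm_smul, Real.norm_of_nonneg (hw0 p).le]
      exact mul_le_of_le_one_right (hw0 p).le (hu1 p)
    · simp only [hv, if_neg h, norm_zero]
      exact (hw0 p).le
  have hvnn : ∀ J, 0 ≤ ∑' p, v J p := fun J => tsum_nonneg fun p => by
    by_cases h : p ∈ J
    · simp only [hv, if_pos h]
      exact smul_nonneg (hw0 p).le (hu p)
    · simp only [hv, if_neg h, le_refl]
  have hvmul : ∀ (J) (p) (z : D), u p * z = z →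
      (∑' q, v J q) * z = if p ∈ J then w p • z else 0 := fun J p z hz => by
    rw [← (hvs J).tsum_mul_right z, tsum_eq_single p]
    · by_cases h : p ∈ J
      · simp only [hv, if_pos h, smul_mul_assoc, hz]
      · simp only [hv, if_neg h, zero_mul]
    · intro q hq
      by_cases h : q ∈ J
      · simp only [hv, if_pos h]
        rw [← hz, ← mul_assoc, smul_mul_assoc, hort q p hq, smul_zero, zero_mul]
      · simp only [hv, if_neg h, zero_mul]
  have hprod : (∑' p, v J p) * (∑' q, v Jᶜ q) = 0 := by
    rw [← (hvs J).tsum_mul_right]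
    refine (tsum_congr fun p => ?_).trans tsum_zero
    rw [← (hvs Jᶜ).tsum_mul_left]
    refine (tsum_congr fun q => ?_).trans tsum_zero
    by_cases hp : p ∈ J
    · by_cases hq : q ∈ J
      · have hq' : q ∉ Jᶜ := fun h => h hq
        simp only [hv, if_neg hq', mul_zero]
      · have hpq : p ≠ q := by rintro rfl; exact hq hp
        simp only [hv, if_pos hp, if_pos (show q ∈ Jᶜ from hq), smul_mul_assoc, mul_smul_comm,
          hort p q hpq, smul_zero]
    · simp only [hv, if_neg hp, zero_mul]
  obtain ⟨e, -, he1, he2⟩ := hD _ _ (hvnn J) (hvnn Jᶜ) hprod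
  refine ⟨e, fun p z hz => ⟨fun hp => ?_, fun hp => ?_⟩⟩
  · have h1 := hvmul J p z hz
    rw [if_pos hp] at h1
    have h2 : e * (w p • z) = w p • z := by rw [← h1, ← mul_assoc, he1]
    rw [mul_smul_comm] at h2
    exact smul_right_injective D (hw0 p).ne' h2
  · have h1 := hvmul Jᶜ p z hz
    rw [if_pos (show p ∈ Jᶜ from hp)] at h1
    have h2 : e * (w p • z) = 0 := by rw [← h1, ← mul_assoc, he2, zero_mul]
    rw [mul_smul_comm] at h2
    exact (smul_eq_zero_iff_right (hw0 p).ne').1 h2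

theorem IsSAWStarAlgebra.of_starAlgEquiv {A D : Type*} [NonUnitalCStarAlgebra A] [PartialOrder A]
    [StarOrderedRing A] [NonUnitalCStarAlgebra D] [PartialOrder D] [StarOrderedRing D]
    (hA : IsSAWStarAlgebra A) (φ : A ≃⋆ₐ[ℂ] D) : IsSAWStarAlgebra D := by
  have hpos : ∀ x : D, 0 ≤ x → 0 ≤ φ.symm x := fun x hx => by
    obtain ⟨y, rfl⟩ := CStarAlgebra.nonneg_iff_eq_star_mul_self.1 hx
    rw [map_mul, map_star]
    exact star_mul_self_nonneg _
  have hpos' : ∀ x : A, 0 ≤ x → 0 ≤ φ x := fun x hx => by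
    obtain ⟨y, rfl⟩ := CStarAlgebra.nonneg_iff_eq_star_mul_self.1 hx
    rw [map_mul, map_star]
    exact star_mul_self_nonneg _
  intro x y hx hy hxy
  obtain ⟨e, he, hex, hey⟩ := hA (φ.symm x) (φ.symm y) (hpos x hx) (hpos y hy)
    (by rw [← map_mul, hxy, map_zero])
  refine ⟨φ e, hpos' e he, ?_, ?_⟩
  · simpa using congrArg φ hex
  · simpa using congrArg φ hey

/-- Bolzano–Weierstrass in `ℂ^ι`: a convergent subsequence is Cauchy. -/
theorem exists_ne_norm_sub_lt {ι : Type*} [Fintype ι] {μ : ℕ → ι → ℂ} {R : ι → ℝ}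
    (hμ : ∀ m i, ‖μ m i‖ ≤ R i) {η : ℝ} (hη : 0 < η) :
    ∃ m m', m ≠ m' ∧ ∀ i, ‖μ m i - μ m' i‖ < η := by
  obtain ⟨l, -, φ, hφ, hl⟩ := tendsto_subseq_of_bounded (x := μ)
    (isCompact_univ_pi fun i => isCompact_closedBall (0 : ℂ) (R i)).isBounded
    (fun m i _ => by simpa using hμ m i)
  obtain ⟨N, hN⟩ := Metric.cauchySeq_iff'.1 hl.cauchySeq η hη
  refine ⟨φ (N + 1), φ N, hφ.injective.ne (by omega), fun i => ?_⟩
  have h := hN (N + 1) (by omega)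
  rw [dist_eq_norm] at h
  exact (norm_le_pi_norm (μ (φ (N + 1)) - μ (φ N)) i).trans_lt h

theorem norm_star_mul_mul_le {E : Type*} [NonUnitalCStarAlgebra E] (z x : E) (hz : ‖z‖ = 1) :
    ‖star z * x * z‖ ≤ ‖x‖ := by
  calc ‖star z * x * z‖ ≤ ‖star z‖ * ‖x‖ * ‖z‖ :=
        (norm_mul_le _ _).trans (by gcongr; exact norm_mul_le _ _)
    _ = ‖x‖ := by rw [norm_star, hz, one_mul, mul_one]

theorem IsCStarTensorMap.not_isSAWStarAlgebra {B C D : Type*}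
    [NonUnitalCStarAlgebra B] [PartialOrder B] [StarOrderedRing B]
    [NonUnitalCStarAlgebra C] [PartialOrder C] [StarOrderedRing C]
    [NonUnitalCStarAlgebra D] [PartialOrder D] [StarOrderedRing D]
    {τ : B →ₗ[ℂ] C →ₗ[ℂ] D} (hτ : IsCStarTensorMap τ)
    (hdense : ∀ (z : D) (ε : ℝ), 0 < ε → ∃ S : Finset (B × C), ‖z - ∑ i ∈ S, τ i.1 i.2‖ < ε)
    (hB : HasOrthogonalSequence B) (hC : HasOrthogonalSequence C) : ¬ IsSAWStarAlgebra D := by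
  intro hD
  obtain ⟨s, hs, hsort⟩ := hB.exists_isLocalUnit
  obtain ⟨t, ht, htort⟩ := hC.exists_isLocalUnit
  obtain ⟨e, he⟩ := hD.exists_separating (u := fun p => τ (s p.1) (t p.2))
    (fun p => hτ.map_nonneg (hs _).nonneg (ht _).nonneg)
    (fun p => by
      rw [hτ.norm_map]
      exact mul_le_one₀ (hs _).norm_le_one (norm_nonneg _) (ht _).norm_le_one)
    (fun p q hpq => by
      rw [← hτ.map_mul]
      by_cases h : p.1 = q.1
      · rw [htort _ _ fun h' => hpq (Prod.ext h h'), map_zero]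
      · rw [hsort _ _ h, map_zero, LinearMap.zero_apply])
    {p | p.1 = p.2}
  obtain ⟨S, hS⟩ := hdense e (1 / 10) (by norm_num)
  set G : ℝ := ∑ i : S, ‖i.1.2‖ with hG
  have hG0 : 0 ≤ G := Finset.sum_nonneg fun _ _ => norm_nonneg _
  -- Chosen so that errors `η` in the `B` legs, weighted by the norms of the `C` legs, total at most
  -- `1 / 10`.
  set η : ℝ := 1 / 10 / (1 + G) with hη
  have hη0 : 0 < η := by positivity
  have hηG : η * G ≤ 1 / 10 := by
    rw [hη, div_mul_eq_mul_div, div_le_iff₀ (by positivity)]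
    nlinarith
  choose s' hs' hss' μ hμ using fun m =>
    exists_excision_family (hs m) (fun i : S => i.1.1) hη0
  choose a ha has using fun m => (hs' m).exists_norm_eq_one
  choose c hc hct using fun n => (ht n).exists_norm_eq_one
  have hsa : ∀ m, s m * a m = a m := fun m => by rw [← has m, ← mul_assoc, hss']
  have haa : ∀ m, ‖star (a m) * a m‖ = 1 := fun m => by
    rw [CStarRing.norm_star_mul_self, ha, one_mul]
  have hcc : ∀ n, ‖star (c n) * c n‖ = 1 := fun n => by
    rw [CStarRing.norm_star_mul_self, hc, one_mul]
  have hexc : ∀ m i, ‖star (a m) * i.1.1 * a m - μ m i • (star (a m) * a m)‖ ≤ η := fun m i => by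
    simpa [ha m] using hμ m i (a m) (has m)
  have hbound : ∀ m i, ‖μ m i‖ ≤ η + ‖i.1.1‖ := fun m i => by
    have h1 : ‖μ m i‖ = ‖μ m i • (star (a m) * a m)‖ := by rw [norm_smul, haa, mul_one]
    rw [h1]
    have h2 := norm_sub_norm_le (μ m i • (star (a m) * a m)) (star (a m) * i.1.1 * a m)
    rw [norm_sub_rev] at h2
    linarith [hexc m i, norm_star_mul_mul_le (a m) i.1.1 (ha m)]
  obtain ⟨m, m', hmm, hclose⟩ := exists_ne_norm_sub_lt hbound hη0
  set h : ℕ → C := fun m => ∑ i : S, μ m i • i.1.2 with hh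
  have hhclose : ‖h m - h m'‖ ≤ 1 / 10 := by
    rw [hh]
    simp only [← Finset.sum_sub_distrib, ← sub_smul]
    refine (norm_sum_le _ _).trans (le_trans ?_ hηG)
    rw [hG, Finset.mul_sum]
    refine Finset.sum_le_sum fun i _ => ?_
    rw [norm_smul]
    exact mul_le_mul_of_nonneg_right (hclose i).le (norm_nonneg _)
  -- Compression by the unit vector `τ (a m) (c n)` turns `e` into `k`. One `1 / 10` pays for
  -- approximating `e`, the other for excision; the cross norm then removes the `B` leg.
  have key : ∀ (m n : ℕ) (k : ℂ), e * τ (a m) (c n) = k • τ (a m) (c n) →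
      ‖star (c n) * h m * c n - k • (star (c n) * c n)‖ ≤ 1 / 5 := by
    intro m n k hk
    set Z := τ (a m) (c n) with hZ
    have hZ1 : ‖Z‖ = 1 := by rw [hZ, hτ.norm_map, ha, hc, one_mul]
    have e1 : ‖star Z * (e - ∑ i ∈ S, τ i.1 i.2) * Z‖ ≤ 1 / 10 := (norm_star_mul_mul_le Z _ hZ1).trans hS.le
    have e2 : star Z * (∑ i ∈ S, τ i.1 i.2) * Z =
        ∑ i : S, τ (star (a m) * i.1.1 * a m) (star (c n) * i.1.2 * c n) := by
      rw [← Finset.sum_coe_sort, Finset.mul_sum, Finset.sum_mul]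
      refine Finset.sum_congr rfl fun i _ => ?_
      rw [hZ, ← hτ.map_star, ← hτ.map_mul, ← hτ.map_mul]
    have e3 : τ (star (a m) * a m) (star (c n) * h m * c n) =
        ∑ i : S, τ (μ m i • (star (a m) * a m)) (star (c n) * i.1.2 * c n) := by
      rw [hh]
      simp only [Finset.mul_sum, Finset.sum_mul, map_sum, mul_smul_comm, smul_mul_assoc, map_smul,
        LinearMap.smul_apply]
    have e4 : ‖star Z * (∑ i ∈ S, τ i.1 i.2) * Z -
        τ (star (a m) * a m) (star (c n) * h m * c n)‖ ≤ 1 / 10 := by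
      rw [e2, e3, ← Finset.sum_sub_distrib]
      refine (norm_sum_le _ _).trans (le_trans ?_ hηG)
      rw [hG, Finset.mul_sum]
      refine Finset.sum_le_sum fun i _ => ?_
      rw [← LinearMap.sub_apply, ← map_sub, hτ.norm_map]
      exact mul_le_mul (hexc m i) (norm_star_mul_mul_le (c n) _ (hc n)) (norm_nonneg _) hη0.le
    have e5 : star Z * e * Z = τ (star (a m) * a m) (k • (star (c n) * c n)) := by
      rw [mul_assoc, hk, mul_smul_comm, hZ, ← hτ.map_star, ← hτ.map_mul, map_smul]
    have e6 : ‖star (c n) * h m * c n - k • (star (c n) * c n)‖ =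
        ‖τ (star (a m) * a m) (star (c n) * h m * c n - k • (star (c n) * c n))‖ := by
      rw [hτ.norm_map, haa, one_mul]
    rw [e6, map_sub, ← e5, norm_sub_rev]
    have e7 : star Z * e * Z - τ (star (a m) * a m) (star (c n) * h m * c n) =
        star Z * (e - ∑ i ∈ S, τ i.1 i.2) * Z + (star Z * (∑ i ∈ S, τ i.1 i.2) * Z -
          τ (star (a m) * a m) (star (c n) * h m * c n)) := by
      rw [mul_sub, sub_mul]; abel
    rw [e7]
    refine (norm_add_le _ _).trans ?_
    linarith
  have hfix : ∀ m n, τ (s m) (t n) * τ (a m) (c n) = τ (a m) (c n) := fun m n => by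
    rw [← hτ.map_mul, hsa, hct]
  -- The same `c m` tests a diagonal and an off-diagonal position. The final count is `1 ≤ 1 / 10 +
  -- 1 / 5 + 1 / 5`.
  have k1 := key m m 1 (by rw [one_smul]; exact (he (m, m) _ (hfix m m)).1 rfl)
  have k2 := key m' m 0 (by rw [zero_smul]; exact (he (m', m) _ (hfix m' m)).2 hmm.symm)
  rw [one_smul] at k1
  rw [zero_smul, sub_zero] at k2
  have k3 : ‖star (c m) * (h m - h m') * c m‖ ≤ 1 / 10 := (norm_star_mul_mul_le (c m) _ (hc m)).trans hhclose
  have k4 : star (c m) * c m = star (c m) * (h m - h m') * c m + star (c m) * h m' * c m -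
      (star (c m) * h m * c m - star (c m) * c m) := by
    rw [mul_sub, sub_mul]; abel
  have k5 := hcc m
  rw [k4] at k5
  have k6 := norm_sub_le (star (c m) * (h m - h m') * c m + star (c m) * h m' * c m)
    (star (c m) * h m * c m - star (c m) * c m)
  have k7 := norm_add_le (star (c m) * (h m - h m') * c m) (star (c m) * h m' * c m)
  linarith

end Nonfactorizability

end

theorem mainTheorem1 {A B C : Type*}
    [NonUnitalCStarAlgebra A] [PartialOrder A] [StarOrderedRing A] (hA : IsSAWStarAlgebra A)
    [NonUnitalCStarAlgebra B] [NonUnitalCStarAlgebra C]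
    (hB : ¬ FiniteDimensional ℂ B) (hC : ¬ FiniteDimensional ℂ C)
    (ν : CStarNorm (B ⊗[ℂ] C)) :
    IsEmpty (A ≃⋆ₐ[ℂ] CStarTensorProduct B C ν) := by
  -- Only `A` comes with an order. The SAW⋆ property transfers to the spectral order because a star
  -- isomorphism preserves elements of the form `star y * y`.
  let _ := CStarAlgebra.spectralOrder B
  have _ := CStarAlgebra.spectralOrderedRing B
  let _ := CStarAlgebra.spectralOrder C
  have _ := CStarAlgebra.spectralOrderedRing C
  let _ := CStarAlgebra.spectralOrder (CStarTensorProduct B C ν)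
  have _ := CStarAlgebra.spectralOrderedRing (CStarTensorProduct B C ν)
  exact ⟨fun φ => ν.isCStarTensorMap_tmul.not_isSAWStarAlgebra
    (fun z _ hε => ν.exists_norm_sub_sum_tmul_lt z hε)
    (hasOrthogonalSequence_of_not_finiteDimensional hB)
    (hasOrthogonalSequence_of_not_finiteDimensional hC) (hA.of_starAlgEquiv φ)⟩
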